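/- **Definitions.** All graphs are finite and simple; $v(H)$ and $e(H)$ denote the numbers of vertices and edges of $H$. For a graph $H$, let $M(H;n)$ be the minimum, over all 2-edge-colourings of $K_n$, of the number of labelled monochromatic copies of $H$ (injective maps from $V(H)$ to $V(K_n)$ that send all edges of $H$ to edges of one and the same colour; if $H$ has no edges, every map is counted once for each colour), and let $$C(H)=\lim_{n\to\infty}\frac{M(H;n)}{n(n-1)\cdots(n-v(H)+1)} .$$ The graph $H$ is *common* if $C(H)=2^{1-e(H)}$. It is *tripartite* if its chromatic number is exactly $3$. For a tree $T$, a graph $H$, $u\in V(T)$ and $v\in V(H)$, let $T*_u^vH$ be the graph obtained from disjoint copies of $T$ and $H$ by identifying $u$ with $v$. *Triangle-trees* are defined recursively: a triangle is a triangle-tree, and any graph obtained from a triangle-tree by identifying a vertex (respectively an edge) of a new triangle with a vertex (respectively an edge) of the triangle-tree is a triangle-tree. Put $\kappa(H)=2e(H)-3v(H)+3$. **Theorem 1.2.** Let $t$ be a positive integer. Then there exists a tripartite common graph $H$ such that $T*_u^vH$ is common for every tree $T$ with $e(T)\le t$, every $u\in V(T)$ and every $v\in V(H)$. Concretely, every triangle-tree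 $H$ with $\kappa(H)\ge t$ is such a graph: it is tripartite and common, and $T*_u^vH$ is common for every tree $T$ with $e(T)\le t$, every $u\in V(T)$ and every $v\in V(H)$. -/

import Mathlib

universe u v

open Filter Topology

/-- `e(H)`, the number of edges of the (finite) graph `H`. -/
noncomputable def edgeCount {V : Type u} (H : SimpleGraph V) : ℕ :=
  Nat.card H.edgeSet

/-- The number of labelled monochromatic copies of `H` in the 2-edge-colouring `c` of `K_n`:
a labelled copy is an injective map from `V(H)` to the vertices of `K_n`, and it has colour `i`
when it sends all edges of `H` to edges of colour `i`. (A graph without edges, for which the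
colour of a copy is not determined, is counted once for each colour.) -/
noncomputable def monoCopies {V : Type u} (H : SimpleGraph V) {n : ℕ}
    (c : SimpleGraph.TopEdgeLabeling (Fin n) (Fin 2)) : ℕ :=
  ∑ i : Fin 2, Nat.card (SimpleGraph.Copy H (c.labelGraph i))

/-- The Ramsey multiplicity `M(H; n)`: the minimum number of labelled monochromatic copies of `H`
over all 2-edge-colourings of `K_n`. -/
noncomputable def ramseyMultiplicity {V : Type u} (H : SimpleGraph V) (n : ℕ) : ℕ :=
  ⨅ c : SimpleGraph.TopEdgeLabeling (Fin n) (Fin 2), monoCopies H c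

/-- `H` is common: the Ramsey multiplicity constant
`C(H) = lim M(H; n) / (n (n - 1) ⋯ (n - v(H) + 1))` equals `2 ^ (1 - e(H))`. -/
def IsCommon {V : Type u} (H : SimpleGraph V) : Prop :=
  Tendsto (fun n : ℕ => (ramseyMultiplicity H n : ℝ) / (n.descFactorial (Nat.card V) : ℝ))
    atTop (𝓝 ((2 : ℝ) ^ (1 - (edgeCount H : ℤ))))

/-- Send a vertex of the second graph to its image after `b` has been identified with the vertex
`a` of the first graph. -/
noncomputable def glueMap {V : Type u} {W : Type v} (a : V) (b : W) (w : W) :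
    V ⊕ {w : W // w ≠ b} :=
  open Classical in if h : w = b then Sum.inl a else Sum.inr ⟨w, h⟩

/-- The graph obtained from disjoint copies of `H` and `T` by identifying the vertex `a` of `H`
with the vertex `b` of `T`. The common vertex is `Sum.inl a`. -/
noncomputable def glueVertex {V : Type u} {W : Type v} (H : SimpleGraph V) (T : SimpleGraph W) (a : V) (b : W) :
    SimpleGraph (V ⊕ {w : W // w ≠ b}) :=
  H.map Sum.inl ⊔ T.map (glueMap a b)

/-- The graph obtained from `H` by adding one new vertex `none`, joined exactly to `a` and `b`.
If `ab` is an edge of `H`, this is the graph obtained by identifying an edge of a new triangle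
with the edge `ab`. -/
noncomputable def glueTriangleOnEdge {V : Type u} (H : SimpleGraph V) (a b : V) : SimpleGraph (Option V) :=
  H.map some ⊔ SimpleGraph.edge none (some a) ⊔ SimpleGraph.edge none (some b)

/-- Triangle-trees: a triangle is a triangle-tree, and identifying a vertex (an edge) of a new
triangle with a vertex (an edge) of a triangle-tree gives a triangle-tree. The last constructor
makes the notion invariant under isomorphism. -/
inductive IsTriangleTree : {V : Type u} → SimpleGraph V → Prop
  | triangle {V : Type u} (hV : Nat.card V = 3) : IsTriangleTree (⊤ : SimpleGraph V)
  | onVertex {V W : Type u} {H : SimpleGraph V} (hH : IsTriangleTree H) (hW : Nat.card W = 3)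
      (a : V) (b : W) : IsTriangleTree (glueVertex H (⊤ : SimpleGraph W) a b)
  | onEdge {V : Type u} {H : SimpleGraph V} (hH : IsTriangleTree H) {a b : V} (hab : H.Adj a b) :
      IsTriangleTree (glueTriangleOnEdge H a b)
  | iso {V W : Type u} {H : SimpleGraph V} {H' : SimpleGraph W} (hH : IsTriangleTree H)
      (e : H ≃g H') : IsTriangleTree H'

/-- `κ(H) = 2 e(H) - 3 v(H) + 3`. -/
noncomputable def kappa {V : Type u} (H : SimpleGraph V) : ℤ :=
  2 * (edgeCount H : ℤ) - 3 * (Nat.card V : ℤ) + 3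

/-! ### Entropy and conditionally independent extensions. -/

section Entropy

open Real

/-! Every graph in question grows from one vertex by `m` pendant edges and `k` apices over existing
edges. The triangle has `(m, k) = (1, 1)`; gluing a triangle on a vertex adds `(1, 1)`, gluing it on
an edge adds `(0, 1)`, and attaching a tree with `s` edges adds `(s, 0)`. Since `κ = k - m`, the
hypothesis `κ ≥ t` leaves `m ≤ k` after a tree with at most `t` edges is attached. So it suffices
that `1 ≤ m ≤ k` implies commonness (`HasPendantApexBuild.isCommon`).

For the lower bound, take a uniform random labelled triangle of `G`, with triple, edge and vertex
entropies `h₃`, `h₂`, `h₁`. Growing a random homomorphism by conditionally independent steps gives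
entropy `k h₃ - (k - m) h₂ - (m - 1) h₁`. As `h₃` is the log of the triangle count while `h₂` and
`h₁` are at most the logs of the arc and vertex counts, `PendantApexBuild.triangleCount_pow_le`
follows. Normalise each count by its value in a random graph, linearise by weighted AM-GM, and add
the inequalities for `G` and its complement: `goodman` bounds the triangle terms from below, and the
arc densities sum to at most 2. The matching upper bound on the Ramsey multiplicity is the average
over all colourings. -/

/-- The entropy of a probability vector supported on `S` is at most `log |S|`. -/
theorem sum_negMulLog_le_log_card {Φ : Type*} [Fintype Φ] (μ : Φ → ℝ) (h0 : ∀ φ, 0 ≤ μ φ)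
    (h1 : ∑ φ, μ φ = 1) (S : Finset Φ) (hS : ∀ φ, μ φ ≠ 0 → φ ∈ S) :
    ∑ φ, negMulLog (μ φ) ≤ log S.card := by
  classical
  have hsum : ∑ φ ∈ S, μ φ = 1 := by
    rw [← h1]
    refine Finset.sum_subset (Finset.subset_univ S) fun φ _ hφ => ?_
    by_contra h
    exact hφ (hS φ h)
  have hcard : (0 : ℝ) < S.card := by
    rcases S.eq_empty_or_nonempty with rfl | h
    · simp at hsum
    · exact_mod_cast h.card_pos
  have hent : ∑ φ, negMulLog (μ φ) = ∑ φ ∈ S, negMulLog (μ φ) := by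
    symm
    refine Finset.sum_subset (Finset.subset_univ S) fun φ _ hφ => ?_
    have : μ φ = 0 := by
      by_contra h
      exact hφ (hS φ h)
    simp [this]
  -- This is `log x ≤ x - 1` at `x = 1 / (|S| μ φ)`, multiplied by `μ φ`; the right-hand sides sum
  -- to zero over `S`.
  have key : ∀ φ ∈ S, negMulLog (μ φ) - μ φ * log S.card ≤ 1 / S.card - μ φ := by
    intro φ _
    rcases (h0 φ).eq_or_lt with h | h
    · simp [← h]
    · have h2 := log_le_sub_one_of_pos (x := 1 / (S.card * μ φ)) (by positivity)
      rw [one_div, log_inv, log_mul hcard.ne' h.ne'] at h2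
      have h3 := mul_le_mul_of_nonneg_left h2 h.le
      have h4 : μ φ * ((S.card * μ φ)⁻¹ - 1) = 1 / S.card - μ φ := by
        field_simp
      rw [h4] at h3
      rw [negMulLog]
      linarith
  have := Finset.sum_le_sum key
  rw [Finset.sum_sub_distrib, Finset.sum_sub_distrib, ← Finset.sum_mul, hsum, Finset.sum_const,
    nsmul_eq_mul, mul_one_div_cancel hcard.ne'] at this
  linarith

/-- Extend the measure `μ` by a conditionally independent coordinate: given `pr φ = s`, the new
coordinate is distributed as `R s / Q s`. -/
noncomputable def condExtend {Φ S A : Type*} (μ : Φ → ℝ) (pr : Φ → S) (Q : S → ℝ) (R : S → A → ℝ)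
    (φ : Φ) (x : A) : ℝ :=
  μ φ * R (pr φ) x / Q (pr φ)

theorem condExtend_nonneg {Φ S A : Type*} [Fintype A] {μ : Φ → ℝ} {pr : Φ → S}
    {Q : S → ℝ} {R : S → A → ℝ} (hμ : ∀ φ, 0 ≤ μ φ) (hR : ∀ s x, 0 ≤ R s x)
    (hRQ : ∀ s, ∑ x, R s x = Q s) (φ : Φ) (x : A) : 0 ≤ condExtend μ pr Q R φ x :=
  div_nonneg (mul_nonneg (hμ _) (hR _ _)) (by rw [← hRQ]; exact Finset.sum_nonneg fun x _ => hR _ x)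

section CondExtend

variable {Φ S A : Type*} [Fintype Φ] [Fintype S] [Fintype A] {μ : Φ → ℝ} {pr : Φ → S}
  {Q : S → ℝ} {R : S → A → ℝ}

/-- Hypothesis `hp` says, through test functions, that `pr` pushes `μ` forward to `Q`. The division
by `Q` in `condExtend` is therefore harmless: where `Q` vanishes, so does `μ`. -/
theorem eq_zero_of_marginal_eq_zero (hμ : ∀ φ, 0 ≤ μ φ)
    (hp : ∀ F : S → ℝ, ∑ φ, μ φ * F (pr φ) = ∑ s, Q s * F s) {φ : Φ} (h : Q (pr φ) = 0) :
    μ φ = 0 := by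
  classical
  have h1 := hp fun s => if s = pr φ then 1 else 0
  simp only [mul_ite, mul_one, mul_zero, Finset.sum_ite_eq', Finset.mem_univ, if_true, h] at h1
  rw [Finset.sum_eq_zero_iff_of_nonneg] at h1
  · simpa using h1 φ (Finset.mem_univ _)
  · intro ψ _
    split_ifs
    exacts [hμ ψ, le_rfl]

theorem sum_condExtend (hμ : ∀ φ, 0 ≤ μ φ) (hRQ : ∀ s, ∑ x, R s x = Q s)
    (hp : ∀ F : S → ℝ, ∑ φ, μ φ * F (pr φ) = ∑ s, Q s * F s) (φ : Φ) :
    ∑ x, condExtend μ pr Q R φ x = μ φ := by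
  simp only [condExtend]
  rw [← Finset.sum_div, ← Finset.mul_sum, hRQ]
  by_cases h : Q (pr φ) = 0
  · simp [eq_zero_of_marginal_eq_zero hμ hp h]
  · field_simp

theorem sum_condExtend_mul (hR : ∀ s x, 0 ≤ R s x) (hRQ : ∀ s, ∑ x, R s x = Q s)
    (hp : ∀ F : S → ℝ, ∑ φ, μ φ * F (pr φ) = ∑ s, Q s * F s) (F : S → A → ℝ) :
    ∑ φ, ∑ x, condExtend μ pr Q R φ x * F (pr φ) x = ∑ s, ∑ x, R s x * F s x := by
  have h1 : ∀ φ, ∑ x, condExtend μ pr Q R φ x * F (pr φ) x =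
      μ φ * (fun s => (∑ x, R s x * F s x) / Q s) (pr φ) := by
    intro φ
    simp only [condExtend, Finset.sum_div, Finset.mul_sum]
    exact Finset.sum_congr rfl fun x _ => by ring
  refine (Finset.sum_congr rfl fun φ _ => h1 φ).trans 
    ((hp fun s => (∑ x, R s x * F s x) / Q s).trans ?_)
  refine Finset.sum_congr rfl fun s _ => ?_
  by_cases h : Q s = 0
  · have h2 : ∀ x, R s x = 0 := by
      have := hRQ s
      rw [h, Finset.sum_eq_zero_iff_of_nonneg fun x _ => hR s x] at this
      exact fun x => this x (Finset.mem_univ x)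
    simp [h2]
  · field_simp

/-- Chain rule: the new coordinate depends on `φ` only through `pr φ`, so it contributes the
conditional entropy of `R` given `Q`. -/
theorem sum_negMulLog_condExtend (hμ : ∀ φ, 0 ≤ μ φ) (hR : ∀ s x, 0 ≤ R s x)
    (hRQ : ∀ s, ∑ x, R s x = Q s)
    (hp : ∀ F : S → ℝ, ∑ φ, μ φ * F (pr φ) = ∑ s, Q s * F s) :
    ∑ φ, ∑ x, negMulLog (condExtend μ pr Q R φ x) =
      ∑ φ, negMulLog (μ φ) + (∑ s, ∑ x, negMulLog (R s x) - ∑ s, negMulLog (Q s)) := by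
  have h1 : ∀ φ x, negMulLog (condExtend μ pr Q R φ x) =
      -(condExtend μ pr Q R φ x * log (μ φ)) -
        condExtend μ pr Q R φ x * (fun s x => log (R s x) - log (Q s)) (pr φ) x := by
    intro φ x
    by_cases h : condExtend μ pr Q R φ x = 0
    · simp [h]
    · have h' := h
      simp only [condExtend, div_eq_zero_iff, mul_eq_zero, not_or] at h'
      obtain ⟨⟨h2, h3⟩, h4⟩ := h'
      rw [negMulLog]
      conv_lhs => rw [condExtend, log_div (mul_ne_zero h2 h3) h4, log_mul h2 h3]
      simp only [condExtend]
      ring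
  simp only [h1, Finset.sum_sub_distrib, Finset.sum_neg_distrib]
  have h2 := sum_condExtend_mul hR hRQ hp fun s x => log (R s x) - log (Q s)
  rw [h2]
  simp only [← Finset.sum_mul, sum_condExtend hμ hRQ hp, mul_sub, Finset.sum_sub_distrib, hRQ,
    negMulLog, neg_mul, Finset.sum_neg_distrib]
  ring

end CondExtend

end Entropy

/-! ### Graphs built by pendant edges and apices. -/

/-- The graph obtained from `H` by adding one new vertex `none`, joined exactly to `a`. -/
def glueEdgeOnVertex {V : Type*} (H : SimpleGraph V) (a : V) : SimpleGraph (Option V) :=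
  H.map some ⊔ SimpleGraph.edge none (some a)

/-- A graph on `V` is built from one vertex by `m` additions of a pendant edge and `k` additions
of a new vertex joined to both ends of an edge. -/
inductive PendantApexBuild : {V : Type} → SimpleGraph V → ℕ → ℕ → Prop
  | single : PendantApexBuild (⊥ : SimpleGraph PUnit) 0 0
  | pendant {V : Type} {H : SimpleGraph V} {m k : ℕ} (hH : PendantApexBuild H m k) (a : V) :
      PendantApexBuild (glueEdgeOnVertex H a) (m + 1) k
  | apex {V : Type} {H : SimpleGraph V} {m k : ℕ} (hH : PendantApexBuild H m k) {a b : V}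
      (hab : H.Adj a b) : PendantApexBuild (glueTriangleOnEdge H a b) m (k + 1)

/-! ### Random homomorphisms with prescribed vertex and edge marginals. -/

section Model

open Real

variable {A : Type*} [Fintype A]

/-- The edge marginal of a weight on triples. -/
noncomputable def edgeMarginal (τ : A → A → A → ℝ) (x y : A) : ℝ := ∑ z, τ x y z

/-- The vertex marginal of a weight on triples. -/
noncomputable def vertexMarginal (τ : A → A → A → ℝ) (x : A) : ℝ := ∑ y, edgeMarginal τ x y

/-- A symmetric probability distribution on the labelled triangles of `G`. -/
structure IsTriangleDistribution (G : SimpleGraph A) (τ : A → A → A → ℝ) : Prop where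
  nonneg : ∀ x y z, 0 ≤ τ x y z
  swap_left : ∀ x y z, τ x y z = τ y x z
  swap_right : ∀ x y z, τ x y z = τ x z y
  adj : ∀ x y z, τ x y z ≠ 0 → G.Adj x y ∧ G.Adj x z ∧ G.Adj y z
  sum_eq_one : ∑ x, ∑ y, ∑ z, τ x y z = 1

/-- The entropy of a weight on triples. -/
noncomputable def tripleEntropy (τ : A → A → A → ℝ) : ℝ := ∑ x, ∑ y, ∑ z, negMulLog (τ x y z)

/-- The entropy of the edge marginal. -/
noncomputable def edgeEntropy (τ : A → A → A → ℝ) : ℝ := ∑ x, ∑ y, negMulLog (edgeMarginal τ x y)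

/-- The entropy of the vertex marginal. -/
noncomputable def vertexEntropy (τ : A → A → A → ℝ) : ℝ := ∑ x, negMulLog (vertexMarginal τ x)

/-- A weight `μ` on maps `V → A`, supported on homomorphisms from `H` to `G`, whose vertex and edge
marginals are those of `τ`. -/
structure IsHomModel {V : Type*} [Fintype V] [DecidableEq V] (G : SimpleGraph A) (τ : A → A → A → ℝ)
    (H : SimpleGraph V) (μ : (V → A) → ℝ) : Prop where
  nonneg : ∀ φ, 0 ≤ μ φ
  adj : ∀ φ, μ φ ≠ 0 → ∀ u v, H.Adj u v → G.Adj (φ u) (φ v)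
  vertex : ∀ v, ∀ F : A → ℝ, ∑ φ, μ φ * F (φ v) = ∑ x, vertexMarginal τ x * F x
  edge : ∀ u v, H.Adj u v → ∀ F : A × A → ℝ,
    ∑ φ, μ φ * F (φ u, φ v) = ∑ s : A × A, edgeMarginal τ s.1 s.2 * F s

namespace IsTriangleDistribution

variable {G : SimpleGraph A} {τ : A → A → A → ℝ}

theorem edgeMarginal_nonneg (h : IsTriangleDistribution G τ) (x y : A) :
    0 ≤ edgeMarginal τ x y :=
  Finset.sum_nonneg fun z _ => h.nonneg x y z

theorem vertexMarginal_nonneg (h : IsTriangleDistribution G τ) (x : A) :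
    0 ≤ vertexMarginal τ x :=
  Finset.sum_nonneg fun y _ => h.edgeMarginal_nonneg x y

theorem edgeMarginal_comm (h : IsTriangleDistribution G τ) (x y : A) :
    edgeMarginal τ x y = edgeMarginal τ y x :=
  Finset.sum_congr rfl fun z _ => h.swap_left x y z

theorem adj_of_edgeMarginal_ne_zero (h : IsTriangleDistribution G τ) {x y : A}
    (hxy : edgeMarginal τ x y ≠ 0) : G.Adj x y := by
  obtain ⟨z, -, hz⟩ := Finset.exists_ne_zero_of_sum_ne_zero hxy
  exact (h.adj x y z hz).1

theorem sum_edgeMarginal_left (h : IsTriangleDistribution G τ) (y : A) :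
    ∑ x, edgeMarginal τ x y = vertexMarginal τ y :=
  Finset.sum_congr rfl fun x _ => h.edgeMarginal_comm x y

theorem sum_triple_fst (h : IsTriangleDistribution G τ) (y z : A) :
    ∑ x, τ x y z = edgeMarginal τ y z := by
  refine Finset.sum_congr rfl fun x _ => ?_
  rw [h.swap_left, h.swap_right]

theorem sum_triple_snd (h : IsTriangleDistribution G τ) (x z : A) :
    ∑ y, τ x y z = edgeMarginal τ x z :=
  Finset.sum_congr rfl fun y _ => h.swap_right x y z

end IsTriangleDistribution

theorem sum_option_fun {V : Type*} [Fintype V] [DecidableEq V] (f : (Option V → A) → ℝ) :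
    ∑ ψ, f ψ = ∑ φ : V → A, ∑ x, f (fun o => o.elim x φ) := by
  classical
  rw [← Equiv.sum_comp (Equiv.piOptionEquivProd (β := fun _ : Option V => A)).symm,
    Fintype.sum_prod_type_right]
  refine Finset.sum_congr rfl fun φ _ => Finset.sum_congr rfl fun x _ => congrArg f ?_
  funext o
  cases o <;> rfl

variable {G : SimpleGraph A} {τ : A → A → A → ℝ}

theorem exists_isHomModel_single (hτ : IsTriangleDistribution G τ) [Fintype PUnit.{1}]
    [DecidableEq PUnit.{1}] :
    ∃ μ, IsHomModel G τ (⊥ : SimpleGraph PUnit.{1}) μ ∧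
      ∑ φ, negMulLog (μ φ) = vertexEntropy τ := by
  have key : ∀ f : (PUnit.{1} → A) → ℝ, ∑ φ, f φ = ∑ x, f (fun _ => x) := by
    intro f
    exact Fintype.sum_equiv (Equiv.funUnique PUnit.{1} A) _ _ fun φ => congrArg f (by ext; rfl)
  refine ⟨fun φ => vertexMarginal τ (φ PUnit.unit),
    ⟨fun φ => hτ.vertexMarginal_nonneg _, ?_, ?_, ?_⟩, ?_⟩
  · intro φ _ u v h
    exact h.elim
  · intro v F
    exact key _
  · intro u v h
    exact h.elim
  · exact key _

theorem map_some_adj {V : Type*} {H : SimpleGraph V} {p q : Option V} :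
    (H.map some).Adj p q ↔ ∃ u v, H.Adj u v ∧ some u = p ∧ some v = q :=
  SimpleGraph.map_adj Function.Embedding.some H p q

theorem glueEdgeOnVertex_adj {V : Type*} {H : SimpleGraph V} {a : V} {p q : Option V} :
    (glueEdgeOnVertex H a).Adj p q ↔
      (∃ u v, H.Adj u v ∧ p = some u ∧ q = some v) ∨ (p = none ∧ q = some a) ∨
        (p = some a ∧ q = none) := by
  cases p <;> cases q <;>
    simp [glueEdgeOnVertex, SimpleGraph.edge_adj, map_some_adj, eq_comm]

theorem glueTriangleOnEdge_adj {V : Type*} {H : SimpleGraph V} {a b : V} {p q : Option V} :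
    (glueTriangleOnEdge H a b).Adj p q ↔
      (∃ u v, H.Adj u v ∧ p = some u ∧ q = some v) ∨
        (p = none ∧ (q = some a ∨ q = some b)) ∨ ((p = some a ∨ p = some b) ∧ q = none) := by
  cases p <;> cases q <;>
    simp [glueTriangleOnEdge, SimpleGraph.edge_adj, map_some_adj, eq_comm]

/-- Draw the new vertex from the edge marginal of `τ` conditioned on the image of `a`. Symmetry of
`τ` gives the new vertex the right marginal and makes the new edge correct in both orientations. -/
theorem IsHomModel.exists_pendant {V : Type*} [Fintype V] [DecidableEq V] {H : SimpleGraph V}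
    {μ : (V → A) → ℝ}
    (hμ : IsHomModel G τ H μ) (hτ : IsTriangleDistribution G τ) (a : V) :
    ∃ μ', IsHomModel G τ (glueEdgeOnVertex H a) μ' ∧
      ∑ φ, negMulLog (μ' φ) = ∑ φ, negMulLog (μ φ) + (edgeEntropy τ - vertexEntropy τ) := by
  have hRQ : ∀ s, ∑ x, edgeMarginal τ s x = vertexMarginal τ s := fun _ => rfl
  have hS := sum_condExtend (R := edgeMarginal τ) hμ.nonneg hRQ (hμ.vertex a)
  have hM := sum_condExtend_mul (R := edgeMarginal τ) hτ.edgeMarginal_nonneg hRQ (hμ.vertex a)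
  set ν := condExtend μ (fun φ => φ a) (vertexMarginal τ) (edgeMarginal τ) with hν
  have hν0 : ∀ φ x, 0 ≤ ν φ x := condExtend_nonneg hμ.nonneg hτ.edgeMarginal_nonneg hRQ
  refine ⟨fun ψ => ν (fun v => ψ (some v)) (ψ none), ⟨fun ψ => hν0 _ _, ?_, ?_, ?_⟩, ?_⟩
  · intro ψ hψ p q hpq
    simp only [hν, condExtend, ne_eq, div_eq_zero_iff, mul_eq_zero, not_or] at hψ
    have hadj := hτ.adj_of_edgeMarginal_ne_zero hψ.1.2
    rcases glueEdgeOnVertex_adj.1 hpq with ⟨u, v, h, rfl, rfl⟩ | ⟨rfl, rfl⟩ | ⟨rfl, rfl⟩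
    · exact hμ.adj _ hψ.1.1 u v h
    · exact hadj.symm
    · exact hadj
  · intro p F
    rw [sum_option_fun]
    cases p with
    | none =>
      have := hM fun _ x => F x
      simp only [Option.elim]
      rw [this, Finset.sum_comm]
      simp only [← Finset.sum_mul, hτ.sum_edgeMarginal_left]
    | some v =>
      simp only [Option.elim, ← Finset.sum_mul, hS]
      exact hμ.vertex v F
  · intro p q hpq F
    rw [sum_option_fun]
    rcases glueEdgeOnVertex_adj.1 hpq with ⟨u, v, h, rfl, rfl⟩ | ⟨rfl, rfl⟩ | ⟨rfl, rfl⟩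
    · simp only [Option.elim, ← Finset.sum_mul, hS]
      exact hμ.edge u v h F
    · have := hM fun s x => F (x, s)
      simp only [Option.elim]
      rw [this, Fintype.sum_prod_type_right]
      simp only [hτ.edgeMarginal_comm]
    · have := hM fun s x => F (s, x)
      simp only [Option.elim]
      rw [this, Fintype.sum_prod_type]
  · rw [sum_option_fun]
    exact sum_negMulLog_condExtend hμ.nonneg hτ.edgeMarginal_nonneg hRQ (hμ.vertex a)

/-- The image of `ab` is distributed as an edge of a `τ`-random triangle, so the new vertex can be
drawn as the third corner of that triangle. By symmetry of `τ` both new edges again have the edge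
marginal, which keeps the construction going. -/
theorem IsHomModel.exists_apex {V : Type*} [Fintype V] [DecidableEq V] {H : SimpleGraph V}
    {μ : (V → A) → ℝ}
    (hμ : IsHomModel G τ H μ) (hτ : IsTriangleDistribution G τ) {a b : V} (hab : H.Adj a b) :
    ∃ μ', IsHomModel G τ (glueTriangleOnEdge H a b) μ' ∧
      ∑ φ, negMulLog (μ' φ) = ∑ φ, negMulLog (μ φ) + (tripleEntropy τ - edgeEntropy τ) := by
  let Q : A × A → ℝ := fun s => edgeMarginal τ s.1 s.2
  let R : A × A → A → ℝ := fun s x => τ s.1 s.2 x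
  have hRQ : ∀ s, ∑ x, R s x = Q s := fun _ => rfl
  have hR : ∀ s x, 0 ≤ R s x := fun s x => hτ.nonneg _ _ _
  have hS := sum_condExtend (R := R) hμ.nonneg hRQ (hμ.edge a b hab)
  have hM := sum_condExtend_mul (R := R) hR hRQ (hμ.edge a b hab)
  have hE := sum_negMulLog_condExtend hμ.nonneg hR hRQ (hμ.edge a b hab)
  set ν := condExtend μ (fun φ => (φ a, φ b)) Q R with hν
  have hν0 : ∀ φ x, 0 ≤ ν φ x := condExtend_nonneg hμ.nonneg hR hRQ
  have hM1 : ∀ F : A × A → ℝ, ∑ φ, ∑ x, ν φ x * F (φ a, x) =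
      ∑ s : A × A, edgeMarginal τ s.1 s.2 * F s := by
    intro F
    rw [hM fun s x => F (s.1, x), Fintype.sum_prod_type, Fintype.sum_prod_type]
    refine Finset.sum_congr rfl fun s _ => ?_
    rw [Finset.sum_comm]
    simp only [← Finset.sum_mul, R, hτ.sum_triple_snd]
  have hM2 : ∀ F : A × A → ℝ, ∑ φ, ∑ x, ν φ x * F (φ b, x) =
      ∑ s : A × A, edgeMarginal τ s.1 s.2 * F s := by
    intro F
    rw [hM fun s x => F (s.2, x), Fintype.sum_prod_type_right, Fintype.sum_prod_type]
    refine Finset.sum_congr rfl fun s _ => ?_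
    rw [Finset.sum_comm]
    simp only [← Finset.sum_mul, R, hτ.sum_triple_fst]
  have hsymm : ∀ F : A × A → ℝ, ∑ s : A × A, edgeMarginal τ s.1 s.2 * F s.swap =
      ∑ s : A × A, edgeMarginal τ s.1 s.2 * F s := by
    intro F
    rw [← Equiv.sum_comp (Equiv.prodComm A A)]
    refine Finset.sum_congr rfl fun s _ => ?_
    simp [hτ.edgeMarginal_comm s.1 s.2]
  refine ⟨fun ψ => ν (fun v => ψ (some v)) (ψ none), ⟨fun ψ => hν0 _ _, ?_, ?_, ?_⟩, ?_⟩
  · intro ψ hψ p q hpq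
    simp only [hν, condExtend, ne_eq, div_eq_zero_iff, mul_eq_zero, not_or] at hψ
    obtain ⟨-, h1, h2⟩ := hτ.adj _ _ _ hψ.1.2
    rcases glueTriangleOnEdge_adj.1 hpq with ⟨u, v, h, rfl, rfl⟩ | ⟨rfl, rfl | rfl⟩ | ⟨rfl | rfl, rfl⟩
    exacts [hμ.adj _ hψ.1.1 u v h, h1.symm, h2.symm, h1, h2]
  · intro p F
    rw [sum_option_fun]
    cases p with
    | none =>
      have := hM1 fun s => F s.2
      simp only [Option.elim]
      rw [this, Fintype.sum_prod_type_right]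
      simp only [← Finset.sum_mul, hτ.sum_edgeMarginal_left]
    | some v =>
      simp only [Option.elim, ← Finset.sum_mul, hS]
      exact hμ.vertex v F
  · intro p q hpq F
    rw [sum_option_fun]
    rcases glueTriangleOnEdge_adj.1 hpq with ⟨u, v, h, rfl, rfl⟩ | ⟨rfl, rfl | rfl⟩ | ⟨rfl | rfl, rfl⟩
    · simp only [Option.elim, ← Finset.sum_mul, hS]
      exact hμ.edge u v h F
    · rw [← hsymm]
      exact hM1 fun s => F s.swap
    · rw [← hsymm]
      exact hM2 fun s => F s.swap
    · exact hM1 F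
    · exact hM2 F
  · rw [sum_option_fun]
    refine hE.trans ?_
    rw [Fintype.sum_prod_type, Fintype.sum_prod_type]
    rfl

theorem PendantApexBuild.exists_isHomModel (hτ : IsTriangleDistribution G τ) {V : Type}
    {H : SimpleGraph V} {m k : ℕ} (hH : PendantApexBuild H m k) :
    ∀ [Fintype V] [DecidableEq V], ∃ μ, IsHomModel G τ H μ ∧ ∑ φ, negMulLog (μ φ) =
      vertexEntropy τ + m * (edgeEntropy τ - vertexEntropy τ) +
        k * (tripleEntropy τ - edgeEntropy τ) := by
  induction hH with
  | single =>
    intro _ _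
    obtain ⟨μ, h, he⟩ := exists_isHomModel_single hτ
    exact ⟨μ, h, by simpa using he⟩
  | @pendant V H m k hH a ih =>
    intro inst inst'
    have := Fintype.ofInjective (some : V → Option V) (Option.some_injective V)
    have : DecidableEq V := (Option.some_injective V).decidableEq
    obtain rfl := Subsingleton.elim inst instFintypeOption
    obtain rfl := Subsingleton.elim inst' Option.instDecidableEq
    obtain ⟨μ, h, he⟩ := ih
    obtain ⟨μ', h', he'⟩ := h.exists_pendant hτ a
    exact ⟨μ', h', by rw [he', he]; push_cast; ring⟩
  | @apex V H m k hH a b hab ih =>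
    intro inst inst'
    have := Fintype.ofInjective (some : V → Option V) (Option.some_injective V)
    have : DecidableEq V := (Option.some_injective V).decidableEq
    obtain rfl := Subsingleton.elim inst instFintypeOption
    obtain rfl := Subsingleton.elim inst' Option.instDecidableEq
    obtain ⟨μ, h, he⟩ := ih
    obtain ⟨μ', h', he'⟩ := h.exists_apex hτ hab
    exact ⟨μ', h', by rw [he', he]; push_cast; ring⟩

end Model

/-! ### Homomorphism counts bounded by triangles, arcs and vertices. -/

section HomCount

open Real

variable {A : Type*} [Fintype A]

open Classical in
/-- The `0/1` adjacency indicator of a graph. -/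
noncomputable def adjIndicator {A : Type*} (G : SimpleGraph A) (x y : A) : ℝ :=
  if G.Adj x y then 1 else 0

/-- The number of ordered adjacent pairs. -/
noncomputable def arcCount (G : SimpleGraph A) : ℝ := ∑ x, ∑ y, adjIndicator G x y

/-- The indicator of ordered triangles. -/
noncomputable def triangleIndicator {A : Type*} (G : SimpleGraph A) (x y z : A) : ℝ :=
  adjIndicator G x y * adjIndicator G x z * adjIndicator G y z

/-- The number of ordered triangles. -/
noncomputable def triangleCount (G : SimpleGraph A) : ℝ := ∑ x, ∑ y, ∑ z, triangleIndicator G x y z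

theorem adjIndicator_nonneg {A : Type*} (G : SimpleGraph A) (x y : A) : 0 ≤ adjIndicator G x y := by
  unfold adjIndicator
  split_ifs <;> norm_num

theorem adjIndicator_comm {A : Type*} (G : SimpleGraph A) (x y : A) :
    adjIndicator G x y = adjIndicator G y x := by
  classical exact if_congr (G.adj_comm x y) rfl rfl

theorem adjIndicator_ne_zero {A : Type*} {G : SimpleGraph A} {x y : A} :
    adjIndicator G x y ≠ 0 ↔ G.Adj x y := by
  simp [adjIndicator]

theorem triangleIndicator_nonneg {A : Type*} (G : SimpleGraph A) (x y z : A) :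
    0 ≤ triangleIndicator G x y z :=
  mul_nonneg (mul_nonneg (adjIndicator_nonneg _ _ _) (adjIndicator_nonneg _ _ _))
    (adjIndicator_nonneg _ _ _)

theorem arcCount_nonneg (G : SimpleGraph A) : 0 ≤ arcCount G :=
  Finset.sum_nonneg fun _ _ => Finset.sum_nonneg fun _ _ => adjIndicator_nonneg _ _ _

theorem triangleCount_nonneg (G : SimpleGraph A) : 0 ≤ triangleCount G :=
  Finset.sum_nonneg fun _ _ => Finset.sum_nonneg fun _ _ => Finset.sum_nonneg fun _ _ =>
    triangleIndicator_nonneg _ _ _ _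

theorem isTriangleDistribution_uniform (G : SimpleGraph A) (hG : 0 < triangleCount G) :
    IsTriangleDistribution G fun x y z => triangleIndicator G x y z / triangleCount G where
  nonneg x y z := div_nonneg (triangleIndicator_nonneg G x y z) hG.le
  swap_left x y z := by
    simp only [triangleIndicator, adjIndicator_comm G y x]
    ring
  swap_right x y z := by
    simp only [triangleIndicator, adjIndicator_comm G z y]
    ring
  adj x y z h := by
    simp only [triangleIndicator, ne_eq, div_eq_zero_iff, mul_eq_zero, not_or] at h
    exact ⟨adjIndicator_ne_zero.1 h.1.1.1, adjIndicator_ne_zero.1 h.1.1.2,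
      adjIndicator_ne_zero.1 h.1.2⟩
  sum_eq_one := by
    simp only [← Finset.sum_div]
    exact div_self hG.ne'

theorem tripleEntropy_uniform (G : SimpleGraph A) (hG : 0 < triangleCount G) :
    tripleEntropy (fun x y z => triangleIndicator G x y z / triangleCount G) =
      log (triangleCount G) := by
  have key : ∀ x y z, negMulLog (triangleIndicator G x y z / triangleCount G) =
      triangleIndicator G x y z / triangleCount G * log (triangleCount G) := by
    intro x y z
    have : triangleIndicator G x y z = 0 ∨ triangleIndicator G x y z = 1 := by
      simp only [triangleIndicator, adjIndicator]
      split_ifs <;> simp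
    rcases this with h | h
    · simp [h]
    · rw [h, negMulLog, one_div, log_inv]
      ring
  simp only [tripleEntropy, key, ← Finset.sum_mul]
  rw [(isTriangleDistribution_uniform G hG).sum_eq_one, one_mul]

theorem edgeEntropy_le {G : SimpleGraph A} {τ : A → A → A → ℝ} (hτ : IsTriangleDistribution G τ) :
    edgeEntropy τ ≤ log (arcCount G) := by
  classical
  have h := sum_negMulLog_le_log_card (fun s : A × A => edgeMarginal τ s.1 s.2)
    (fun s => hτ.edgeMarginal_nonneg _ _)
    (by rw [Fintype.sum_prod_type]; exact hτ.sum_eq_one)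
    (Finset.univ.filter fun s : A × A => G.Adj s.1 s.2)
    (fun s hs => by simpa using hτ.adj_of_edgeMarginal_ne_zero hs)
  rw [Fintype.sum_prod_type] at h
  refine h.trans (le_of_eq (congrArg log ?_))
  rw [Finset.card_filter]
  push_cast
  rw [Fintype.sum_prod_type]
  simp only [arcCount, adjIndicator]

theorem vertexEntropy_le {G : SimpleGraph A} {τ : A → A → A → ℝ}
    (hτ : IsTriangleDistribution G τ) : vertexEntropy τ ≤ log (Fintype.card A) :=
  sum_negMulLog_le_log_card _ hτ.vertexMarginal_nonneg hτ.sum_eq_one Finset.univ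
    fun _ _ => Finset.mem_univ _

theorem PendantApexBuild.nonempty {V : Type} {H : SimpleGraph V} {m k : ℕ}
    (hH : PendantApexBuild H m k) : Nonempty V := by
  induction hH <;> infer_instance

theorem PendantApexBuild.finite {V : Type} {H : SimpleGraph V} {m k : ℕ}
    (hH : PendantApexBuild H m k) : Finite V := by
  induction hH <;> infer_instance

/-- The number of homomorphisms from a built graph is bounded below in terms of the numbers of
triangles, arcs and vertices. -/
theorem PendantApexBuild.triangleCount_pow_le {V : Type} {H : SimpleGraph V} {m k : ℕ}
    (hH : PendantApexBuild H m k) (hm : 1 ≤ m) (hmk : m ≤ k) (G : SimpleGraph A) :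
    triangleCount G ^ k ≤
      Nat.card (H →g G) * (Fintype.card A : ℝ) ^ (m - 1) * arcCount G ^ (k - m) := by
  classical
  rcases (triangleCount_nonneg G).eq_or_lt with h0 | hpos
  · rw [← h0, zero_pow (by omega)]
    have := arcCount_nonneg G
    positivity
  have hτ := isTriangleDistribution_uniform G hpos
  have h3 := tripleEntropy_uniform G hpos
  have h2 := edgeEntropy_le hτ
  have h1 := vertexEntropy_le hτ
  set τ : A → A → A → ℝ := fun x y z => triangleIndicator G x y z / triangleCount G
  have := hH.finite
  have := Fintype.ofFinite V
  obtain ⟨v⟩ := hH.nonempty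
  obtain ⟨μ, hμ, hent⟩ := hH.exists_isHomModel hτ
  have hsum : ∑ φ, μ φ = 1 := by
    have := hμ.vertex v fun _ => 1
    simp only [mul_one] at this
    exact this.trans hτ.sum_eq_one
  let S : Finset (V → A) := Finset.univ.filter fun φ => ∀ u v, H.Adj u v → G.Adj (φ u) (φ v)
  have hS : ∀ φ, μ φ ≠ 0 → φ ∈ S := fun φ hφ => by simpa [S] using hμ.adj φ hφ
  have hle := sum_negMulLog_le_log_card μ hμ.nonneg hsum S hS
  have hScard : Nat.card (H →g G) = S.card := by
    rw [← Nat.subtype_card (p := fun φ : V → A => ∀ u v, H.Adj u v → G.Adj (φ u) (φ v)) S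
      (by simp [S])]
    exact Nat.card_congr ⟨fun f => ⟨f, fun u v h => f.map_adj h⟩,
      fun f => ⟨f.1, fun {u v} h => f.2 u v h⟩, fun _ => rfl, fun _ => rfl⟩
  obtain ⟨φ, -, hφ⟩ := Finset.exists_ne_zero_of_sum_ne_zero (hsum.trans_ne one_ne_zero)
  have hSpos : (0 : ℝ) < S.card := by exact_mod_cast Finset.card_pos.2 ⟨φ, hS φ hφ⟩
  have hApos : (0 : ℝ) < Fintype.card A := by
    exact_mod_cast Fintype.card_pos_iff.2 ⟨φ v⟩
  have hEpos : 0 < arcCount G := by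
    obtain ⟨x, -, hx⟩ := Finset.exists_ne_zero_of_sum_ne_zero (hτ.sum_eq_one.trans_ne one_ne_zero)
    obtain ⟨y, -, hy⟩ := Finset.exists_ne_zero_of_sum_ne_zero hx
    have hadj := adjIndicator_ne_zero.2 (hτ.adj_of_edgeMarginal_ne_zero hy)
    refine lt_of_lt_of_le ((adjIndicator_nonneg G x y).lt_of_ne' hadj) ?_
    refine (Finset.single_le_sum (f := fun y => adjIndicator G x y)
      (fun y _ => adjIndicator_nonneg G x y) (Finset.mem_univ y)).trans ?_
    exact Finset.single_le_sum (f := fun x => ∑ y, adjIndicator G x y)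
      (fun x _ => Finset.sum_nonneg fun y _ => adjIndicator_nonneg G x y) (Finset.mem_univ x)
  -- After logarithms the claim is `k h₃ ≤ log |S| + (m - 1) log |A| + (k - m) log (arcCount G)`.
  -- The conditions `1 ≤ m ≤ k` make both coefficients nonnegative, so the upper bounds on `h₁` and
  -- `h₂` may be used.
  rw [hScard, ← log_le_log_iff (by positivity) (by positivity), log_mul (by positivity)
    (by positivity), log_mul (by positivity) (by positivity), log_pow, log_pow, log_pow,
    Nat.cast_sub hm, Nat.cast_sub hmk]
  rw [hent, h3] at hle
  have hm' : (0 : ℝ) ≤ m - 1 := by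
    rw [sub_nonneg]
    exact_mod_cast hm
  have hk' : (0 : ℝ) ≤ k - m := by
    rw [sub_nonneg]
    exact_mod_cast hmk
  have := mul_le_mul_of_nonneg_left h1 hm'
  have := mul_le_mul_of_nonneg_left h2 hk'
  push_cast
  linarith

/-! ### Goodman's inequality and the sum over complementary graphs. -/

/-- Goodman's inequality for ordered triangles. -/
theorem goodman (G : SimpleGraph A) :
    (Fintype.card A : ℝ) ^ 3 / 4 - 3 * (Fintype.card A : ℝ) ^ 2 ≤
      triangleCount G + triangleCount Gᶜ := by
  classical
  let s : A → A → ℝ := fun x y => adjIndicator G x y - adjIndicator Gᶜ x y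
  have hs : ∀ x y, s x y = s y x := fun x y => by
    simp only [s, adjIndicator_comm G x y, adjIndicator_comm Gᶜ x y]
  let d : A → A → ℝ := fun x y => if x = y then 1 else 0
  -- For distinct vertices this is an equality: the three products of signs sum to 3 on a
  -- monochromatic triple and to -1 otherwise. The terms `d` absorb the triples with repeated
  -- vertices. Each product pairs two edges at a common vertex, so its total is a sum of squares.
  have key : ∀ x y z, 1 / 4 + (s x y * s x z + s y x * s y z + s z x * s z y) / 4 -
      (d x y + d x z + d y z) ≤ triangleIndicator G x y z + triangleIndicator Gᶜ x y z := by
    intro x y z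
    rw [hs y x, hs z x, hs z y]
    by_cases hxy : x = y
    · subst hxy
      simp only [s, d, triangleIndicator, adjIndicator, SimpleGraph.compl_adj, SimpleGraph.irrefl]
      split_ifs <;> simp_all <;> norm_num
    by_cases hxz : x = z
    · subst hxz
      simp only [s, d, triangleIndicator, adjIndicator, SimpleGraph.compl_adj, SimpleGraph.irrefl]
      split_ifs <;> simp_all <;> norm_num
    by_cases hyz : y = z
    · subst hyz
      simp only [s, d, triangleIndicator, adjIndicator, SimpleGraph.compl_adj, SimpleGraph.irrefl]
      split_ifs <;> simp_all <;> norm_num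
    by_cases h1 : G.Adj x y <;> by_cases h2 : G.Adj x z <;> by_cases h3 : G.Adj y z <;>
      simp [s, d, triangleIndicator, adjIndicator, hxy, hxz, hyz, h1, h2, h3] <;> norm_num
  have hsq : ∀ x, 0 ≤ ∑ y, ∑ z, s x y * s x z := by
    intro x
    rw [← Finset.sum_mul_sum]
    exact mul_self_nonneg _
  have hsum := Finset.sum_le_sum fun x (_ : x ∈ Finset.univ) => Finset.sum_le_sum
    fun y (_ : y ∈ Finset.univ) => Finset.sum_le_sum fun z (_ : z ∈ Finset.univ) => key x y z
  simp only [Finset.sum_add_distrib, Finset.sum_sub_distrib, ← Finset.sum_div] at hsum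
  have e1 : ∑ x, ∑ y, ∑ z, s y x * s y z = ∑ x, ∑ y, ∑ z, s x y * s x z := Finset.sum_comm
  have e2 : ∑ x, ∑ y, ∑ z, s z x * s z y = ∑ x, ∑ y, ∑ z, s x y * s x z := by
    rw [Finset.sum_comm_cycle]
  have hpos : 0 ≤ ∑ x, ∑ y, ∑ z, s x y * s x z := Finset.sum_nonneg fun x _ => hsq x
  have d1 : ∑ x : A, ∑ y : A, ∑ _z : A, d x y = (Fintype.card A : ℝ) ^ 2 := by
    simp [d, sq]
  have d2 : ∑ x : A, ∑ _y : A, ∑ z : A, d x z = (Fintype.card A : ℝ) ^ 2 := by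
    simp [d, sq]
  have d3 : ∑ _x : A, ∑ y : A, ∑ z : A, d y z = (Fintype.card A : ℝ) ^ 2 := by
    simp [d, sq]
  rw [e1, e2, d1, d2, d3] at hsum
  have h4 : ∑ _x : A, ∑ _y : A, ∑ _z : A, (1 : ℝ) = (Fintype.card A : ℝ) ^ 3 := by
    simp
    ring
  rw [h4] at hsum
  simp only [triangleCount]
  linarith

theorem arcCount_add_compl_le (G : SimpleGraph A) :
    arcCount G + arcCount Gᶜ ≤ (Fintype.card A : ℝ) ^ 2 := by
  have key : ∀ x y, adjIndicator G x y + adjIndicator Gᶜ x y ≤ 1 := by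
    intro x y
    by_cases h : G.Adj x y
    · simp [adjIndicator, h]
    · simp only [adjIndicator, SimpleGraph.compl_adj, h]
      split_ifs <;> simp_all
  have := Finset.sum_le_sum fun x (_ : x ∈ Finset.univ) => Finset.sum_le_sum
    fun y (_ : y ∈ Finset.univ) => key x y
  simp only [Finset.sum_add_distrib] at this
  refine this.trans (le_of_eq ?_)
  simp [sq]

/-- A weighted form of the arithmetic-geometric mean inequality. -/
theorem mul_le_add_of_pow_le {x p a : ℝ} {j k : ℕ} (hx : 0 ≤ x) (hp : 0 ≤ p)
    (hjk : j + 1 ≤ k) (h : a ^ k ≤ x * p ^ j) :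
    k * a ≤ x + j * p + (k - 1 - j) := by
  have hk : (0 : ℝ) < k := by exact_mod_cast (by omega : 0 < k)
  have hjk' : (0 : ℝ) ≤ k - 1 - j := by
    have : ((j + 1 : ℕ) : ℝ) ≤ k := by exact_mod_cast hjk
    push_cast at this
    linarith
  have hj : (0 : ℝ) ≤ j := Nat.cast_nonneg j
  rcases le_total a 0 with ha | ha
  · nlinarith [mul_nonneg hj hp]
  -- The point 1 pads the weights of `x` and `p` to total 1 without changing the geometric mean.
  have amgm := geom_mean_le_arith_mean3_weighted (w₁ := 1 / k) (w₂ := j / k) (w₃ := (k - 1 - j) / k)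
    (p₁ := x) (p₂ := p) (p₃ := 1) (by positivity) (by positivity) (by positivity) hx hp zero_le_one
    (by field_simp; ring)
  rw [one_rpow, mul_one] at amgm
  have h1 : x ^ (1 / k : ℝ) * p ^ (j / k : ℝ) = (x * p ^ j) ^ (1 / k : ℝ) := by
    rw [mul_rpow hx (by positivity), ← rpow_natCast p j, ← rpow_mul hp]
    congr 2
    ring
  have h2 : a ≤ (x * p ^ j) ^ (1 / k : ℝ) := by
    calc a = (a ^ k) ^ (1 / k : ℝ) := by
          rw [← rpow_natCast, ← rpow_mul ha, mul_one_div_cancel hk.ne', rpow_one]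
      _ ≤ _ := rpow_le_rpow (by positivity) h (by positivity)
  rw [h1] at amgm
  have h3 := mul_le_mul_of_nonneg_left (h2.trans amgm) hk.le
  refine h3.trans (le_of_eq ?_)
  field_simp

/-- Homomorphism counts in complementary graphs. -/
theorem PendantApexBuild.le_homCount_add_compl {V : Type} {H : SimpleGraph V} {m k : ℕ}
    (hH : PendantApexBuild H m k) (hm : 1 ≤ m) (hmk : m ≤ k) [Nonempty A] (G : SimpleGraph A) :
    (Fintype.card A : ℝ) ^ (1 + m + k) / 2 ^ (m + 2 * k) * (2 - 24 * k / Fintype.card A) ≤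
      Nat.card (H →g G) + Nat.card (H →g Gᶜ) := by
  have hn : (0 : ℝ) < Fintype.card A := by exact_mod_cast Fintype.card_pos
  have h1 := hH.triangleCount_pow_le hm hmk G
  have h2 := hH.triangleCount_pow_le hm hmk Gᶜ
  have hg := goodman G
  have ha := arcCount_add_compl_le G
  obtain ⟨j, rfl⟩ := Nat.exists_eq_add_of_le hmk
  obtain ⟨i, rfl⟩ := Nat.exists_eq_add_of_le hm
  generalize (Fintype.card A : ℝ) = n at *
  set e := 1 + i + 2 * (1 + i + j) with he
  set v := 1 + (1 + i) + (1 + i + j) with hv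
  -- Each count is divided by its order of magnitude in a uniformly random graph, so that all three
  -- densities are near 1 there; the powers of 2 and of `n` then cancel exactly.
  have key : ∀ G' : SimpleGraph A, triangleCount G' ^ (1 + i + j) ≤ Nat.card (H →g G') *
      n ^ (1 + i - 1) * arcCount G' ^ (1 + i + j - (1 + i)) →
      ((1 + i + j : ℕ) : ℝ) * (8 * triangleCount G' / n ^ 3) ≤
        2 ^ e * Nat.card (H →g G') / n ^ v + j * (2 * arcCount G' / n ^ 2) +
          ((1 + i + j : ℕ) - 1 - j) := by
    intro G' h
    have := arcCount_nonneg G'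
    refine mul_le_add_of_pow_le (by positivity) (by positivity) (by omega) ?_
    rw [div_pow, mul_pow, show 1 + i + j - (1 + i) = j by omega,
      show 1 + i - 1 = i by omega] at *
    calc 8 ^ (1 + i + j) * triangleCount G' ^ (1 + i + j) / (n ^ 3) ^ (1 + i + j)
        ≤ 8 ^ (1 + i + j) * (Nat.card (H →g G') * n ^ i * arcCount G' ^ j) /
          (n ^ 3) ^ (1 + i + j) := by gcongr
      _ = 2 ^ e * Nat.card (H →g G') / n ^ v * (2 * arcCount G' / n ^ 2) ^ j := by
        rw [div_pow, mul_pow, show (8 : ℝ) = 2 ^ 3 by norm_num, ← pow_mul, ← pow_mul, ← pow_mul,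
          div_mul_div_comm, ← pow_add, div_eq_div_iff (by positivity) (by positivity)]
        have e1 : 3 * (1 + i + j) = e + j := by omega
        have e2 : 3 * (1 + i + j) = i + (v + 2 * j) := by omega
        rw [show (n : ℝ) ^ (3 * (1 + i + j)) = n ^ i * n ^ (v + 2 * j) by rw [e2, pow_add],
          e1, pow_add]
        ring
  have k1 := key G h1
  have k2 := key Gᶜ h2
  have hk : (0 : ℝ) ≤ (1 + i + j : ℕ) := Nat.cast_nonneg _
  have hj : (0 : ℝ) ≤ j := Nat.cast_nonneg _
  have g1 : 2 - 24 / n ≤ 8 * triangleCount G / n ^ 3 + 8 * triangleCount Gᶜ / n ^ 3 := by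
    rw [← add_div, le_div_iff₀ (by positivity)]
    have : (2 - 24 / n) * n ^ 3 = 8 * (n ^ 3 / 4 - 3 * n ^ 2) := by
      field_simp
      ring
    rw [this]
    linarith
  have a1 : 2 * arcCount G / n ^ 2 + 2 * arcCount Gᶜ / n ^ 2 ≤ 2 := by
    rw [← add_div, div_le_iff₀ (by positivity)]
    linarith
  have g2 := mul_le_mul_of_nonneg_left g1 hk
  have a2 := mul_le_mul_of_nonneg_left a1 hj
  -- Of the `2k` from Goodman, the arcs use at most `2j` and the constants `2(k - 1 - j)`, which
  -- leaves 2.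
  have fin : 2 - 24 * ((1 + i + j : ℕ) : ℝ) / n ≤
      2 ^ e * Nat.card (H →g G) / n ^ v + 2 ^ e * Nat.card (H →g Gᶜ) / n ^ v := by
    have : ((1 + i + j : ℕ) : ℝ) * (2 - 24 / n) =
      2 * (1 + i + j : ℕ) - 24 * ((1 + i + j : ℕ) : ℝ) / n := by ring
    linarith
  rw [← add_div, ← mul_add, le_div_iff₀ (by positivity)] at fin
  rw [div_mul_eq_mul_div, div_le_iff₀ (by positivity)]
  linarith

end HomCount

/-! ### From homomorphism counts to commonness. -/

section Common

open SimpleGraph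

/-- Colourings that are constant `i` on the image of `g`. -/
theorem card_constant_on_mul_le {E F : Type*} [Finite E] [Finite F] (g : F → E)
    (hg : Function.Injective g) (i : Fin 2) :
    Nat.card {c : E → Fin 2 // ∀ x, c (g x) = i} * 2 ^ Nat.card F ≤ Nat.card (E → Fin 2) := by
  have h : Nat.card (F → Fin 2) = 2 ^ Nat.card F := by
    rw [Nat.card_fun, Nat.card_fin]
  rw [← h, ← Nat.card_prod]
  -- Overwrite `c` on the image of `g` by an arbitrary `d`. Nothing is lost, since `c` was
  -- constantly `i` there.
  refine Nat.card_le_card_of_injective (fun p => Function.extend g p.2 p.1.1) ?_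
  rintro ⟨⟨c, hc⟩, d⟩ ⟨⟨c', hc'⟩, d'⟩ heq
  simp only at heq
  have hd : d = d' := by
    funext x
    have := congrFun heq (g x)
    rwa [hg.extend_apply, hg.extend_apply] at this
  have hcc : c = c' := by
    funext e
    by_cases he : ∃ x, g x = e
    · obtain ⟨x, rfl⟩ := he
      rw [hc, hc']
    · have := congrFun heq e
      rwa [Function.extend_apply' _ _ _ he, Function.extend_apply' _ _ _ he] at this
  subst hd hcc
  rfl

/-- An embedding of vertices as a homomorphism to the complete graph. -/
def topHom {V W : Type*} (H : SimpleGraph V) (f : V ↪ W) : H →g (⊤ : SimpleGraph W) :=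
  ⟨f, fun h => f.injective.ne h.ne⟩

theorem card_copy_labelGraph {V : Type*} (H : SimpleGraph V) {n : ℕ}
    (c : TopEdgeLabeling (Fin n) (Fin 2)) (i : Fin 2) :
    Nat.card (Copy H (c.labelGraph i)) =
      Nat.card {f : V ↪ Fin n // ∀ x, c ((topHom H f).mapEdgeSet x) = i} := by
  refine Nat.card_congr ⟨fun f => ⟨⟨f, f.injective⟩, ?_⟩, fun f => ⟨⟨f.1, ?_⟩, f.1.injective⟩,
    fun _ => rfl, fun _ => rfl⟩
  · rintro ⟨e, he⟩
    induction e with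
    | _ a b =>
      obtain ⟨_, h⟩ := (EdgeLabeling.labelGraph_adj _ _).1 (f.toHom.map_adj he)
      exact h
  · intro a b hab
    exact (EdgeLabeling.labelGraph_adj _ _).2
      ⟨f.1.injective.ne hab.ne, f.2 ⟨s(a, b), hab⟩⟩

/-- The average over random colourings bounds the Ramsey multiplicity from above. -/
theorem ramseyMultiplicity_mul_le {V : Type*} [Finite V] (H : SimpleGraph V) (n : ℕ) :
    ramseyMultiplicity H n * 2 ^ edgeCount H ≤ 2 * n.descFactorial (Nat.card V) := by
  classical
  have := Fintype.ofFinite V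
  let C := TopEdgeLabeling (Fin n) (Fin 2)
  have hC : 0 < Fintype.card C := Fintype.card_pos
  have hcol : ∀ i : Fin 2, (∑ c : C, Nat.card (Copy H (c.labelGraph i))) * 2 ^ edgeCount H ≤
      Fintype.card C * n.descFactorial (Nat.card V) := by
    intro i
    -- Double counting of pairs (colouring, embedding) in which the embedded copy has colour `i`.
    let r : C → (V ↪ Fin n) → Prop := fun c f => ∀ x, c ((topHom H f).mapEdgeSet x) = i
    have h1 : ∑ c : C, Nat.card (Copy H (c.labelGraph i)) =
        ∑ f : V ↪ Fin n, Nat.card {c : C // r c f} := by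
      have := Finset.sum_card_bipartiteAbove_eq_sum_card_bipartiteBelow (s := Finset.univ)
        (t := Finset.univ) r
      simp only [Finset.bipartiteAbove, Finset.bipartiteBelow, ← Fintype.card_subtype,
        ← Nat.card_eq_fintype_card] at this
      rw [← this]
      exact Finset.sum_congr rfl fun c _ => card_copy_labelGraph H c i
    rw [h1, Finset.sum_mul]
    have h2 : ∀ f : V ↪ Fin n, Nat.card {c : C // r c f} * 2 ^ edgeCount H ≤ Fintype.card C := by
      intro f
      rw [← Nat.card_eq_fintype_card]
      exact card_constant_on_mul_le _ (Hom.mapEdgeSet.injective _ f.injective) i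
    refine (Finset.sum_le_sum fun f _ => h2 f).trans (le_of_eq ?_)
    rw [Finset.sum_const, Finset.card_univ, Fintype.card_embedding_eq, Fintype.card_fin,
      Nat.card_eq_fintype_card, smul_eq_mul, mul_comm]
  have hle : Fintype.card C * ramseyMultiplicity H n ≤ ∑ c : C, monoCopies H c := by
    rw [← smul_eq_mul, ← Finset.card_univ]
    exact Finset.card_nsmul_le_sum _ _ _ fun c _ => ciInf_le (OrderBot.bddBelow _) c
  refine Nat.le_of_mul_le_mul_left ?_ hC
  calc Fintype.card C * (ramseyMultiplicity H n * 2 ^ edgeCount H)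
      ≤ (∑ c : C, monoCopies H c) * 2 ^ edgeCount H := by
        rw [← mul_assoc]
        exact Nat.mul_le_mul_right _ hle
    _ = ∑ i : Fin 2, (∑ c : C, Nat.card (Copy H (c.labelGraph i))) * 2 ^ edgeCount H := by
        simp only [monoCopies]
        rw [Finset.sum_comm, Finset.sum_mul]
    _ ≤ ∑ _i : Fin 2, Fintype.card C * n.descFactorial (Nat.card V) :=
        Finset.sum_le_sum fun i _ => hcol i
    _ = _ := by
        simp
        ring

/-- Homomorphisms that are not copies are non-injective maps, of which there are `n ^ v(H)` minus
the falling factorial. This is of lower order, so copies may be replaced by homomorphisms in the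
limit. -/
theorem card_hom_add_descFactorial_le {V : Type*} [Finite V] (H : SimpleGraph V) {n : ℕ}
    (G : SimpleGraph (Fin n)) :
    Nat.card (H →g G) + n.descFactorial (Nat.card V) ≤ Nat.card (Copy H G) + n ^ Nat.card V := by
  classical
  have := Fintype.ofFinite V
  have h1 : Nat.card (H →g G) ≤
      Nat.card (Copy H G) + Nat.card {φ : V → Fin n // ¬ Function.Injective φ} := by
    have : Finite (H →g G) := Finite.of_injective _ (DFunLike.coe_injective (F := H →g G))
    have : Finite (Copy H G) :=
      Finite.of_injective (fun f : Copy H G => (f : V → Fin n)) DFunLike.coe_injective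
    rw [← Nat.card_sum]
    refine Nat.card_le_card_of_injective
      (fun f => if h : Function.Injective f then Sum.inl ⟨f, h⟩ else Sum.inr ⟨f, h⟩) ?_
    intro f g hfg
    simp only at hfg
    split_ifs at hfg with hf hg hg
    · simpa using hfg
    · exact DFunLike.coe_injective (by simpa using hfg)
  have h2 : n.descFactorial (Nat.card V) + Nat.card {φ : V → Fin n // ¬ Function.Injective φ} =
      n ^ Nat.card V := by
    have e1 : Nat.card {φ : V → Fin n // Function.Injective φ} = n.descFactorial (Nat.card V) := by
      rw [Nat.card_congr (Equiv.subtypeInjectiveEquivEmbedding V (Fin n)),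
        Nat.card_eq_fintype_card, Fintype.card_embedding_eq, Fintype.card_fin,
        Nat.card_eq_fintype_card]
    rw [← e1, ← Nat.card_sum, Nat.card_congr (Equiv.sumCompl _)]
    simp
  omega

theorem labelGraph_one_eq_compl {n : ℕ} (c : TopEdgeLabeling (Fin n) (Fin 2)) :
    c.labelGraph 1 = (c.labelGraph 0)ᶜ := by
  ext x y
  rw [compl_adj, TopEdgeLabeling.labelGraph_adj, TopEdgeLabeling.labelGraph_adj]
  by_cases h : x = y
  · simp [h]
  · simp only [h, not_false_eq_true, exists_true_left, true_and, ne_eq]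
    generalize EdgeLabeling.get c x y _ = i
    fin_cases i <;> simp

theorem tendsto_pow_div_descFactorial (k : ℕ) :
    Tendsto (fun n : ℕ => (n : ℝ) ^ k / (n.descFactorial k : ℝ)) atTop (𝓝 1) := by
  have h := (isEquivalent_descFactorial k).symm
  rwa [Asymptotics.isEquivalent_iff_tendsto_one] at h
  filter_upwards [eventually_ge_atTop k] with n hn
  exact_mod_cast (Nat.descFactorial_pos.2 hn).ne'

theorem two_zpow_one_sub (e : ℕ) : (2 : ℝ) ^ (1 - (e : ℤ)) = 2 / 2 ^ e := by
  rw [zpow_sub₀ two_ne_zero, zpow_one, zpow_natCast]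

/-- A graph whose homomorphism counts in complementary graphs are asymptotically at least those
in random graphs is common. -/
theorem isCommon_of_homCount {V : Type*} [Finite V] (H : SimpleGraph V) (K : ℝ)
    (hK : ∀ n : ℕ, 0 < n → ∀ G : SimpleGraph (Fin n),
      (n : ℝ) ^ Nat.card V / 2 ^ edgeCount H * (2 - K / n) ≤
        Nat.card (H →g G) + Nat.card (H →g Gᶜ)) : IsCommon H := by
  rw [IsCommon, two_zpow_one_sub]
  set w := Nat.card V with hw
  set e := edgeCount H with he
  -- The lower bound of the squeeze: the bound `hK`, minus the non-injective maps counted once per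
  -- colour, divided by the falling factorial.
  have hlim : Tendsto (fun n : ℕ => (n : ℝ) ^ w / (n.descFactorial w : ℝ) *
      (1 / 2 ^ e * (2 - K / n) - 2) + 2) atTop (𝓝 (2 / 2 ^ e)) := by
    have h1 : Tendsto (fun n : ℕ => K / (n : ℝ)) atTop (𝓝 0) := tendsto_const_div_atTop_nhds_zero_nat K
    have h2 := ((tendsto_pow_div_descFactorial w).mul
      (((h1.const_sub 2).const_mul (1 / 2 ^ e)).sub_const 2)).add_const 2
    refine h2.trans (le_of_eq (congrArg 𝓝 ?_))
    ring
  refine tendsto_of_tendsto_of_tendsto_of_le_of_le' hlim tendsto_const_nhds ?_ ?_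
  · filter_upwards [eventually_ge_atTop w, eventually_gt_atTop 0] with n hn hn0
    have hd : (0 : ℝ) < n.descFactorial w := by exact_mod_cast Nat.descFactorial_pos.2 hn
    obtain ⟨c, hc⟩ := Nat.sInf_mem
      (Set.range_nonempty fun c : TopEdgeLabeling (Fin n) (Fin 2) => monoCopies H c)
    have hc' : ramseyMultiplicity H n = monoCopies H c := hc.symm
    have a0 := card_hom_add_descFactorial_le H (c.labelGraph 0)
    have a1 := card_hom_add_descFactorial_le H (c.labelGraph 1)
    have b := hK n hn0 (c.labelGraph 0)
    rw [← labelGraph_one_eq_compl] at b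
    rw [← hw] at a0 a1
    rw [hc', monoCopies, Fin.sum_univ_two, le_div_iff₀ hd]
    have a : (Nat.card (H →g c.labelGraph 0) : ℝ) + Nat.card (H →g c.labelGraph 1) +
        2 * n.descFactorial w ≤ ((Nat.card (Copy H (c.labelGraph 0)) +
          Nat.card (Copy H (c.labelGraph 1)) : ℕ) : ℝ) + 2 * n ^ w := by
      exact_mod_cast (by omega : Nat.card (H →g c.labelGraph 0) + Nat.card (H →g c.labelGraph 1) +
        2 * n.descFactorial w ≤ (Nat.card (Copy H (c.labelGraph 0)) +
          Nat.card (Copy H (c.labelGraph 1))) + 2 * n ^ w)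
    have e1 : ((n : ℝ) ^ w / (n.descFactorial w : ℝ) * (1 / 2 ^ e * (2 - K / n) - 2) + 2) *
        n.descFactorial w = (n : ℝ) ^ w / 2 ^ e * (2 - K / n) - 2 * n ^ w +
          2 * n.descFactorial w := by
      field_simp
    rw [e1]
    linarith
  · filter_upwards [eventually_ge_atTop w] with n hn
    have hd : (0 : ℝ) < n.descFactorial w := by exact_mod_cast Nat.descFactorial_pos.2 hn
    rw [div_le_div_iff₀ hd (by positivity)]
    exact_mod_cast ramseyMultiplicity_mul_le H n

end Common

/-! ### Invariants of built graphs and recognition up to isomorphism. -/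

section Build

open SimpleGraph

theorem edgeCount_sup_edge {V : Type*} [Finite V] (G : SimpleGraph V) {s t : V}
    (hn : ¬ G.Adj s t) (hst : s ≠ t) :
    edgeCount (G ⊔ SimpleGraph.edge s t) = edgeCount G + 1 := by
  classical
  have := Fintype.ofFinite V
  have h := G.card_edgeFinset_sup_edge hn hst
  rw [edgeFinset_card, edgeFinset_card] at h
  rw [edgeCount, edgeCount, Nat.card_eq_fintype_card, Nat.card_eq_fintype_card]
  exact h

theorem edgeCount_map_some {V : Type*} (H : SimpleGraph V) :
    edgeCount (H.map some) = edgeCount H := by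
  have h := H.edgeSet_map Function.Embedding.some
  rw [edgeCount, edgeCount]
  change Nat.card (H.map Function.Embedding.some).edgeSet = _
  rw [h]
  exact Nat.card_image_of_injective Function.Embedding.some.sym2Map.injective _

theorem edgeCount_congr {V W : Type*} {H : SimpleGraph V} {J : SimpleGraph W} (e : H ≃g J) :
    edgeCount H = edgeCount J :=
  Nat.card_congr e.mapEdgeSet

namespace PendantApexBuild

variable {V : Type} {H : SimpleGraph V} {m k : ℕ}

theorem card_eq (hH : PendantApexBuild H m k) : Nat.card V = 1 + m + k := by
  induction hH with
  | single => simp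
  | pendant hH a ih =>
    have := hH.finite
    rw [Finite.card_option, ih]
    ring
  | apex hH hab ih =>
    have := hH.finite
    rw [Finite.card_option, ih]
    ring

theorem edgeCount_eq (hH : PendantApexBuild H m k) : edgeCount H = m + 2 * k := by
  induction hH with
  | single => simp [edgeCount]
  | pendant hH a ih =>
    have := hH.finite
    rw [glueEdgeOnVertex, edgeCount_sup_edge _ (by simp [map_some_adj]) (by simp), edgeCount_map_some, ih]
    ring
  | apex hH hab ih =>
    have := hH.finite
    rw [glueTriangleOnEdge, edgeCount_sup_edge _
      (by simp [map_some_adj, SimpleGraph.edge_adj, hab.ne']) (by simp),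
      edgeCount_sup_edge _ (by simp [map_some_adj]) (by simp), edgeCount_map_some, ih]
    ring

/-- Each new vertex has at most two neighbours when it is added, so a third colour is free. -/
theorem colorable_three (hH : PendantApexBuild H m k) : H.Colorable 3 := by
  have hex : ∀ x y : Fin 3, ∃ c, c ≠ x ∧ c ≠ y := by decide
  induction hH with
  | single => exact ⟨Coloring.mk (fun _ => 0) fun h => h.elim⟩
  | pendant hH a ih =>
    obtain ⟨C⟩ := ih
    obtain ⟨c, hc, -⟩ := hex (C a) (C a)
    refine ⟨Coloring.mk (fun o => o.elim c C) ?_⟩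
    intro p q hpq
    rcases glueEdgeOnVertex_adj.1 hpq with ⟨u, v, h, rfl, rfl⟩ | ⟨rfl, rfl⟩ | ⟨rfl, rfl⟩
    exacts [C.valid h, hc, hc.symm]
  | @apex _ _ _ _ hH a b hab ih =>
    obtain ⟨C⟩ := ih
    obtain ⟨c, ha, hb⟩ := hex (C a) (C b)
    refine ⟨Coloring.mk (fun o => o.elim c C) ?_⟩
    intro p q hpq
    rcases glueTriangleOnEdge_adj.1 hpq with ⟨u, v, h, rfl, rfl⟩ | ⟨rfl, rfl | rfl⟩ | ⟨rfl | rfl, rfl⟩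
    exacts [C.valid h, ha, hb, ha.symm, hb.symm]

theorem exists_triangle (hH : PendantApexBuild H m k) (hk : 1 ≤ k) :
    ∃ x y z, H.Adj x y ∧ H.Adj x z ∧ H.Adj y z := by
  induction hH with
  | single => omega
  | pendant hH a ih =>
    obtain ⟨x, y, z, h1, h2, h3⟩ := ih hk
    exact ⟨some x, some y, some z, glueEdgeOnVertex_adj.2 (.inl ⟨_, _, h1, rfl, rfl⟩),
      glueEdgeOnVertex_adj.2 (.inl ⟨_, _, h2, rfl, rfl⟩), glueEdgeOnVertex_adj.2 (.inl ⟨_, _, h3, rfl, rfl⟩)⟩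
  | @apex _ _ _ _ hH a b hab ih =>
    exact ⟨none, some a, some b, glueTriangleOnEdge_adj.2 (by simp), glueTriangleOnEdge_adj.2 (by simp),
      glueTriangleOnEdge_adj.2 (.inl ⟨_, _, hab, rfl, rfl⟩)⟩

theorem chromaticNumber_eq_three (hH : PendantApexBuild H m k) (hk : 1 ≤ k) :
    H.chromaticNumber = 3 := by
  classical
  have h3 := hH.colorable_three
  refine le_antisymm h3.chromaticNumber_le ?_
  obtain ⟨x, y, z, h⟩ := hH.exists_triangle hk
  have hc := is3Clique_triple_iff.2 h
  have := hc.1.card_le_chromaticNumber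
  rwa [hc.2] at this

/-- The witness is a book: `t` apices over one fixed edge. -/
theorem exists_one_left (t : ℕ) : ∃ (V : Type) (H : SimpleGraph V) (a b : V), H.Adj a b ∧
    PendantApexBuild H 1 t := by
  induction t with
  | zero =>
    exact ⟨_, _, none, some PUnit.unit, glueEdgeOnVertex_adj.2 (by simp), single.pendant PUnit.unit⟩
  | succ t ih =>
    obtain ⟨V, H, a, b, hab, hH⟩ := ih
    exact ⟨_, _, some a, some b, glueTriangleOnEdge_adj.2 (.inl ⟨_, _, hab, rfl, rfl⟩), hH.apex hab⟩

end PendantApexBuild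

/-- `J` is isomorphic to a graph built from one vertex by `m` pendant edges and `k` apices. -/
def HasPendantApexBuild {X : Type*} (J : SimpleGraph X) (m k : ℕ) : Prop :=
  ∃ (V : Type) (H : SimpleGraph V), PendantApexBuild H m k ∧ Nonempty (H ≃g J)

theorem nonempty_option_iso {V X : Type*} {K : SimpleGraph (Option V)} {J : SimpleGraph X}
    {g : V → X} {x : X} (hg : Function.Injective g) (hx : ∀ v, g v ≠ x)
    (hsurj : ∀ y, y = x ∨ ∃ v, g v = y)
    (hadj : ∀ u v, J.Adj (g u) (g v) ↔ K.Adj (some u) (some v))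
    (hxadj : ∀ v, J.Adj x (g v) ↔ K.Adj none (some v)) : Nonempty (K ≃g J) := by
  refine ⟨⟨Equiv.ofBijective (fun o : Option V => o.elim x g) ⟨?_, ?_⟩, ?_⟩⟩
  · rintro (_ | u) (_ | v) h
    · rfl
    · exact (hx v h.symm).elim
    · exact (hx u h).elim
    · exact congrArg some (hg h)
  · intro y
    rcases hsurj y with rfl | ⟨v, rfl⟩
    exacts [⟨none, rfl⟩, ⟨some v, rfl⟩]
  · rintro (_ | u) (_ | v)
    · simp
    · exact hxadj v
    · change J.Adj (g u) x ↔ _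
      rw [J.adj_comm, K.adj_comm, hxadj]
    · exact hadj u v

namespace HasPendantApexBuild

variable {V X : Type*} {H : SimpleGraph V} {J : SimpleGraph X} {m k : ℕ}

theorem of_iso (hH : HasPendantApexBuild H m k) (e : H ≃g J) : HasPendantApexBuild J m k := by
  obtain ⟨V₀, H₀, h, ⟨f⟩⟩ := hH
  exact ⟨V₀, H₀, h, ⟨f.trans e⟩⟩

theorem pendant (hH : HasPendantApexBuild H m k) {f : V → X} {x : X} {a : V}
    (hf : Function.Injective f) (hx : ∀ v, f v ≠ x) (hsurj : ∀ y, y = x ∨ ∃ v, f v = y)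
    (hadj : ∀ u v, J.Adj (f u) (f v) ↔ H.Adj u v) (hxadj : ∀ v, J.Adj x (f v) ↔ v = a) :
    HasPendantApexBuild J (m + 1) k := by
  obtain ⟨V₀, H₀, h, ⟨e⟩⟩ := hH
  refine ⟨_, _, h.pendant (e.symm a), nonempty_option_iso (g := f ∘ e) (x := x)
    (hf.comp e.injective) (fun v => hx _) (fun y => ?_) (fun u v => ?_) (fun v => ?_)⟩
  · rcases hsurj y with h | ⟨v, rfl⟩
    exacts [.inl h, .inr ⟨e.symm v, by simp⟩]
  · simp [glueEdgeOnVertex_adj, hadj, e.map_adj_iff]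
  · simp [glueEdgeOnVertex_adj, hxadj, RelIso.eq_symm_apply]

theorem apex (hH : HasPendantApexBuild H m k) {f : V → X} {x : X} {a b : V} (hab : H.Adj a b)
    (hf : Function.Injective f) (hx : ∀ v, f v ≠ x) (hsurj : ∀ y, y = x ∨ ∃ v, f v = y)
    (hadj : ∀ u v, J.Adj (f u) (f v) ↔ H.Adj u v)
    (hxadj : ∀ v, J.Adj x (f v) ↔ v = a ∨ v = b) :
    HasPendantApexBuild J m (k + 1) := by
  obtain ⟨V₀, H₀, h, ⟨e⟩⟩ := hH
  refine ⟨_, _, h.apex (e.symm.map_adj_iff.2 hab), nonempty_option_iso (g := f ∘ e) (x := x)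
    (hf.comp e.injective) (fun v => hx _) (fun y => ?_) (fun u v => ?_) (fun v => ?_)⟩
  · rcases hsurj y with h | ⟨v, rfl⟩
    exacts [.inl h, .inr ⟨e.symm v, by simp⟩]
  · simp [glueTriangleOnEdge_adj, hadj, e.map_adj_iff]
  · simp [glueTriangleOnEdge_adj, hxadj, RelIso.eq_symm_apply]

theorem finite (hH : HasPendantApexBuild H m k) : Finite V := by
  obtain ⟨V₀, H₀, h, ⟨e⟩⟩ := hH
  have := h.finite
  exact Finite.of_equiv _ e.toEquiv

theorem card_eq (hH : HasPendantApexBuild H m k) : Nat.card V = 1 + m + k := by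
  obtain ⟨V₀, H₀, h, ⟨e⟩⟩ := hH
  rw [← h.card_eq, Nat.card_congr e.toEquiv]

theorem edgeCount_eq (hH : HasPendantApexBuild H m k) : edgeCount H = m + 2 * k := by
  obtain ⟨V₀, H₀, h, ⟨e⟩⟩ := hH
  rw [← h.edgeCount_eq, edgeCount_congr e]

/-- A pendant edge changes `κ` by `2 - 3 = -1` and an apex by `4 - 3 = 1`; a single vertex has `κ =
0`. -/
theorem kappa_eq (hH : HasPendantApexBuild H m k) : kappa H = k - m := by
  rw [kappa, hH.edgeCount_eq, hH.card_eq]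
  push_cast
  ring

theorem chromaticNumber_eq_three (hH : HasPendantApexBuild H m k) (hk : 1 ≤ k) :
    H.chromaticNumber = 3 := by
  obtain ⟨V₀, H₀, h, ⟨e⟩⟩ := hH
  rw [← h.chromaticNumber_eq_three hk]
  exact le_antisymm (chromaticNumber_mono_of_hom e.symm.toHom)
    (chromaticNumber_mono_of_hom e.toHom)

/-- A built graph with at least as many apices as pendant edges is common. -/
theorem isCommon (hH : HasPendantApexBuild H m k) (hm : 1 ≤ m) (hmk : m ≤ k) : IsCommon H := by
  have := hH.finite
  refine isCommon_of_homCount H (24 * k) fun n hn G => ?_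
  rw [hH.card_eq, hH.edgeCount_eq]
  obtain ⟨V₀, H₀, h, ⟨e⟩⟩ := hH
  have hcard : ∀ G' : SimpleGraph (Fin n), Nat.card (H →g G') = Nat.card (H₀ →g G') := fun G' =>
    Nat.card_congr ⟨fun f => f.comp e.toHom, fun f => f.comp e.symm.toHom,
      fun f => by ext x; simp, fun f => by ext x; simp⟩
  have : Nonempty (Fin n) := ⟨⟨0, hn⟩⟩
  have := h.le_homCount_add_compl hm hmk G
  rwa [Fintype.card_fin, ← hcard, ← hcard] at this

end HasPendantApexBuild

/-! ### Gluing trees and triangles as pendant and apex steps. -/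

section Glue

variable {V W : Type*} {H : SimpleGraph V} {T : SimpleGraph W} {a : V} {b : W}

theorem glueMap_self (a : V) (b : W) : glueMap a b b = Sum.inl a := dif_pos rfl

theorem glueMap_of_ne (a : V) {b w : W} (h : w ≠ b) : glueMap a b w = Sum.inr ⟨w, h⟩ := dif_neg h

theorem glueMap_eq_inl {w : W} {v : V} : glueMap a b w = Sum.inl v ↔ w = b ∧ v = a := by
  by_cases h : w = b
  · subst h
    simp [glueMap_self, eq_comm]
  · simp [glueMap_of_ne a h, h]

theorem glueMap_eq_inr {w : W} {x : {w : W // w ≠ b}} :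
    glueMap a b w = Sum.inr x ↔ w = x := by
  by_cases h : w = b
  · subst h
    simp [glueMap_self, x.2.symm]
  · simp [glueMap_of_ne a h, Subtype.ext_iff]

theorem glueVertex_adj_inl_inl {u v : V} :
    (glueVertex H T a b).Adj (Sum.inl u) (Sum.inl v) ↔ H.Adj u v := by
  simp only [glueVertex, sup_adj, map_adj', glueMap_eq_inl]
  constructor
  · rintro (⟨-, u', v', h, hu, hv⟩ | ⟨h, w, w', h', ⟨rfl, rfl⟩, ⟨rfl, rfl⟩⟩)
    · rwa [← Sum.inl_injective hu, ← Sum.inl_injective hv]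
    · exact (h rfl).elim
  · intro h
    exact .inl ⟨by simpa using h.ne, u, v, h, rfl, rfl⟩

theorem glueVertex_adj_inr_inl {x : {w : W // w ≠ b}} {v : V} :
    (glueVertex H T a b).Adj (Sum.inr x) (Sum.inl v) ↔ v = a ∧ T.Adj x b := by
  simp only [glueVertex, sup_adj, map_adj', glueMap_eq_inl, glueMap_eq_inr]
  aesop

theorem glueVertex_adj_inr_inr {x y : {w : W // w ≠ b}} :
    (glueVertex H T a b).Adj (Sum.inr x) (Sum.inr y) ↔ T.Adj x y := by
  simp only [glueVertex, sup_adj, map_adj', glueMap_eq_inr]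
  constructor
  · rintro (⟨-, u', v', h, hu, hv⟩ | ⟨h, w, w', h', rfl, rfl⟩)
    · simp at hu
    · exact h'
  · intro h
    exact .inr ⟨fun h' => h.ne (congrArg Subtype.val (Sum.inr_injective h')), x, y, h, rfl, rfl⟩

theorem HasPendantApexBuild.glueVertex_of_card {m k : ℕ} (hH : HasPendantApexBuild H m k) (a : V)
    (N : ℕ) : ∀ {W : Type v} [Finite W] (T : SimpleGraph W), T.IsTree → Nat.card W = N + 1 →
      ∀ b : W, HasPendantApexBuild (glueVertex H T a b) (m + N) k := by
  induction N with
  | zero =>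
    intro W _ T hT hW b
    obtain ⟨hs, -⟩ := Nat.card_eq_one_iff_unique.1 hW
    refine hH.of_iso ⟨⟨Sum.inl, Sum.elim id fun x => (x.2 (Subsingleton.elim _ _)).elim,
      fun v => rfl, ?_⟩, glueVertex_adj_inl_inl⟩
    rintro (v | x)
    exacts [rfl, (x.2 (Subsingleton.elim _ _)).elim]
  | succ N ih =>
    intro W _ T hT hW b
    classical
    have := Fintype.ofFinite W
    have : Nontrivial W := Finite.one_lt_card_iff_nontrivial.1 (by omega)
    -- A nontrivial tree has two leaves, so one of them is not the root `b`. Deleting it leaves a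
    -- smaller tree still glued at `b`.
    obtain ⟨x, hxb, hdeg⟩ : ∃ x, x ≠ b ∧ T.degree x = 1 := by
      obtain ⟨x, y, hxy, hx, hy⟩ := hT.exists_ne_and_degree_eq_one
      by_cases h : x = b
      · exact ⟨y, h ▸ hxy.symm, hy⟩
      · exact ⟨x, h, hx⟩
    obtain ⟨y, hxy, hy⟩ := degree_eq_one_iff_existsUnique_adj.1 hdeg
    have hT' : (T.induce {x}ᶜ).IsTree :=
      ⟨hT.connected.induce_compl_singleton_of_degree_eq_one hdeg, hT.isAcyclic.induce _⟩
    have hW' : Nat.card ({x}ᶜ : Set W) = N + 1 := by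
      have := Set.ncard_compl_add_ncard ({x} : Set W)
      rw [Set.ncard_singleton, hW] at this
      rw [Nat.card_coe_set_eq]
      omega
    let b' : ({x}ᶜ : Set W) := ⟨b, hxb.symm⟩
    let y' : ({x}ᶜ : Set W) := ⟨y, hxy.ne'⟩
    have hb : ∀ w : {w : ({x}ᶜ : Set W) // w ≠ b'}, (w : W) ≠ b := fun w h =>
      w.2 (Subtype.ext h)
    have hadj : ∀ w, T.Adj x w ↔ w = y := fun w => ⟨hy w, fun h => h ▸ hxy⟩
    -- The deleted leaf returns as a pendant edge at the image of its neighbour `y`, which is `a`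
    -- itself when `y = b`.
    refine (ih _ hT' hW' b').pendant
      (f := Sum.map id fun w : {w : ({x}ᶜ : Set W) // w ≠ b'} => (⟨w, hb w⟩ : {w : W // w ≠ b}))
      (x := Sum.inr ⟨x, hxb⟩) (a := glueMap a b' y') ?_ ?_ ?_ ?_ ?_
    · refine Function.Injective.sumMap Function.injective_id fun w w' h => ?_
      exact Subtype.ext (Subtype.ext (congrArg (fun z : {w : W // w ≠ b} => (z : W)) h))
    · rintro (v | w) h
      · simp at h
      · exact w.1.2 (congrArg Subtype.val (Sum.inr_injective h))
    · rintro (v | w)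
      · exact .inr ⟨.inl v, rfl⟩
      · by_cases h : (w : W) = x
        · exact .inl (congrArg Sum.inr (Subtype.ext h))
        · exact .inr ⟨.inr ⟨⟨w, h⟩, fun h' => w.2 (congrArg Subtype.val h')⟩, rfl⟩
    · rintro (u | w) (v | w')
      · exact glueVertex_adj_inl_inl.trans glueVertex_adj_inl_inl.symm
      · rw [SimpleGraph.adj_comm, SimpleGraph.adj_comm _ (Sum.inl u)]
        exact glueVertex_adj_inr_inl.trans
          (glueVertex_adj_inr_inl (T := T.induce {x}ᶜ) (b := b')).symm
      · exact glueVertex_adj_inr_inl.trans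
          (glueVertex_adj_inr_inl (T := T.induce {x}ᶜ) (b := b')).symm
      · exact glueVertex_adj_inr_inr.trans
          (glueVertex_adj_inr_inr (T := T.induce {x}ᶜ) (b := b')).symm
    · rintro (v | w)
      · rw [eq_comm, glueMap_eq_inl]
        refine glueVertex_adj_inr_inl.trans ?_
        rw [hadj, Subtype.ext_iff]
        exact and_comm.trans (and_congr eq_comm Iff.rfl)
      · rw [eq_comm, glueMap_eq_inr]
        refine glueVertex_adj_inr_inr.trans ?_
        rw [hadj, Subtype.ext_iff, eq_comm]

/-- Attaching a tree adds one pendant edge for each edge of the tree. -/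
theorem HasPendantApexBuild.glueVertex_tree {m k : ℕ} (hH : HasPendantApexBuild H m k) [Finite W]
    (hT : T.IsTree) (a : V) (b : W) :
    HasPendantApexBuild (glueVertex H T a b) (m + edgeCount T) k := by
  classical
  have := Fintype.ofFinite W
  refine hH.glueVertex_of_card a _ T hT ?_ b
  have h := hT.card_edgeFinset
  rw [edgeFinset_card] at h
  rw [edgeCount, Nat.card_eq_fintype_card, Nat.card_eq_fintype_card, h]

theorem exists_of_card_eq_three (hW : Nat.card W = 3) (b : W) :
    ∃ c d : {w : W // w ≠ b}, c ≠ d ∧ ∀ x, x = c ∨ x = d := by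
  classical
  have : Finite W := Nat.finite_of_card_ne_zero (by omega)
  have h : Nat.card {w : W // w ≠ b} = 2 := by
    have h1 := Nat.card_congr (Equiv.optionSubtypeNe b)
    rw [Finite.card_option, hW] at h1
    omega
  obtain ⟨c, d, hcd, h⟩ := Nat.card_eq_two_iff.1 h
  exact ⟨c, d, hcd, fun x => by simpa using h.symm.subset (Set.mem_univ x)⟩

/-- Attach one side of the triangle at `a` as a pendant edge, then put the last corner as an apex
over that edge. -/
theorem HasPendantApexBuild.glueVertex_triangle {m k : ℕ} (hH : HasPendantApexBuild H m k)
    (hW : Nat.card W = 3) (a : V) (b : W) :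
    HasPendantApexBuild (glueVertex H (⊤ : SimpleGraph W) a b) (m + 1) (k + 1) := by
  obtain ⟨c, d, hcd, hall⟩ := exists_of_card_eq_three hW b
  have hK : HasPendantApexBuild (glueEdgeOnVertex H a) (m + 1) k :=
    hH.pendant (f := some) (x := none) (a := a) (Option.some_injective V) (by simp)
      (by rintro (_ | v) <;> simp) (by simp [glueEdgeOnVertex_adj]) (by simp [glueEdgeOnVertex_adj])
  refine hK.apex (f := fun o => o.elim (Sum.inr c) Sum.inl) (x := Sum.inr d) (a := none)
    (b := some a) (by simp [glueEdgeOnVertex_adj]) ?_ ?_ ?_ ?_ ?_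
  · rintro (_ | u) (_ | v) h <;> simp_all
  · rintro (_ | u) <;> simp [hcd]
  · rintro (v | w)
    · exact .inr ⟨some v, rfl⟩
    · rcases hall w with rfl | rfl
      exacts [.inr ⟨none, rfl⟩, .inl rfl]
  · rintro (_ | u) (_ | v)
    · simp
    · simp only [Option.elim]
      rw [glueVertex_adj_inr_inl]
      simp [glueEdgeOnVertex_adj, c.2]
    · simp only [Option.elim]
      rw [SimpleGraph.adj_comm, glueVertex_adj_inr_inl]
      simp [glueEdgeOnVertex_adj, c.2]
    · simp only [Option.elim]
      rw [glueVertex_adj_inl_inl]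
      simp [glueEdgeOnVertex_adj]
  · rintro (_ | v)
    · simp only [Option.elim]
      rw [glueVertex_adj_inr_inr]
      simpa [Subtype.ext_iff] using fun h => hcd (Subtype.ext h.symm)
    · simp only [Option.elim]
      rw [glueVertex_adj_inr_inl]
      simp [d.2]

theorem hasPendantApexBuild_triangle (hV : Nat.card V = 3) :
    HasPendantApexBuild (⊤ : SimpleGraph V) 1 1 := by
  have : Finite V := Nat.finite_of_card_ne_zero (by omega)
  obtain ⟨b⟩ : Nonempty V := Finite.card_pos_iff.1 (by omega)
  have h0 : HasPendantApexBuild (⊥ : SimpleGraph PUnit.{1}) 0 0 :=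
    ⟨_, _, PendantApexBuild.single, ⟨SimpleGraph.Iso.refl⟩⟩
  refine (h0.glueVertex_triangle hV PUnit.unit b).of_iso
    ⟨Equiv.ofBijective (Sum.elim (fun _ => b) Subtype.val) ⟨?_, ?_⟩, ?_⟩
  · rintro (u | w) (v | w') h
    · rfl
    · exact (w'.2 h.symm).elim
    · exact (w.2 h).elim
    · exact congrArg Sum.inr (Subtype.ext h)
  · intro w
    by_cases h : w = b
    exacts [⟨.inl PUnit.unit, h.symm⟩, ⟨.inr ⟨w, h⟩, rfl⟩]
  · rintro (u | w) (v | w')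
    · rw [glueVertex_adj_inl_inl]
      simp
    · rw [SimpleGraph.adj_comm (glueVertex _ _ _ _), glueVertex_adj_inr_inl]
      simp [w'.2]
    · rw [glueVertex_adj_inr_inl]
      simp [w.2]
    · rw [glueVertex_adj_inr_inr]
      simp [Subtype.ext_iff]

/-- The initial triangle already gives `1 ≤ m`, which the exponent `m - 1` in the counting bound
requires. -/
theorem IsTriangleTree.exists_hasPendantApexBuild {V : Type u} {H : SimpleGraph V}
    (hH : IsTriangleTree H) : ∃ m k, HasPendantApexBuild H m k ∧ 1 ≤ m ∧ 1 ≤ k := by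
  induction hH with
  | triangle hV => exact ⟨1, 1, hasPendantApexBuild_triangle hV, le_rfl, le_rfl⟩
  | onVertex hH hW a b ih =>
    obtain ⟨m, k, h, hm, hk⟩ := ih
    exact ⟨_, _, h.glueVertex_triangle hW a b, by omega, by omega⟩
  | onEdge hH hab ih =>
    obtain ⟨m, k, h, hm, hk⟩ := ih
    refine ⟨m, k + 1, h.apex (f := some) (x := none) hab (Option.some_injective _) (by simp)
      (by rintro (_ | v) <;> simp) (by simp [glueTriangleOnEdge_adj]) (by simp [glueTriangleOnEdge_adj]), hm,
      by omega⟩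
  | iso hH e ih =>
    obtain ⟨m, k, h, hm, hk⟩ := ih
    exact ⟨m, k, h.of_iso e, hm, hk⟩

theorem HasPendantApexBuild.isCommon_and_isCommon_glueVertex {m k t : ℕ}
    (hH : HasPendantApexBuild H m k) (hm : 1 ≤ m) (hk : m + t ≤ k) :
    H.chromaticNumber = 3 ∧ IsCommon H ∧
      ∀ {W : Type v} [Finite W] (T : SimpleGraph W), T.IsTree → edgeCount T ≤ t →
        ∀ (b : W) (a : V), IsCommon (glueVertex H T a b) :=
  ⟨hH.chromaticNumber_eq_three (by omega), hH.isCommon hm (by omega),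
    fun _ hT hTt b a => (hH.glueVertex_tree hT a b).isCommon (by omega) (by omega)⟩

end Glue

end Build

theorem theorem1p2 (t : ℕ) (ht : 0 < t) :
    -- there is a tripartite common graph that stays common after adding any tree of size at most t
    (∃ (n : ℕ) (H : SimpleGraph (Fin n)), H.chromaticNumber = 3 ∧ IsCommon H ∧
      ∀ {W : Type v} [Finite W] (T : SimpleGraph W), T.IsTree → edgeCount T ≤ t →
        ∀ (b : W) (a : Fin n), IsCommon (glueVertex H T a b)) ∧
    -- every triangle-tree with κ at least t is such a graph
    (∀ {V : Type u} [Finite V] (H : SimpleGraph V), IsTriangleTree H → (t : ℤ) ≤ kappa H →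
      H.chromaticNumber = 3 ∧ IsCommon H ∧
      ∀ {W : Type v} [Finite W] (T : SimpleGraph W), T.IsTree → edgeCount T ≤ t →
        ∀ (b : W) (a : V), IsCommon (glueVertex H T a b)) := by
  refine ⟨?_, fun {V} _ H hH hκ => ?_⟩
  · obtain ⟨V, H, -, -, -, hH⟩ := PendantApexBuild.exists_one_left (t + 1)
    have := hH.finite
    have e := Finite.equivFin V
    have h : HasPendantApexBuild (H.map e.toEmbedding) 1 (t + 1) :=
      ⟨V, H, hH, ⟨SimpleGraph.Iso.map e H⟩⟩
    exact ⟨_, _, h.isCommon_and_isCommon_glueVertex le_rfl (by omega)⟩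
  · obtain ⟨m, k, h, hm, hk⟩ := hH.exists_hasPendantApexBuild
    rw [h.kappa_eq] at hκ
    exact h.isCommon_and_isCommon_glueVertex hm (by omega)
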